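/- Let $d\ge 1$, let $\Omega\subset\tilde\Omega\subset\mathbb R^d$ be bounded open sets and $Y=(0,1)^d$. A function of $(x,y)$ is called $Y$-periodic if it is $\mathbb Z^d$-periodic in $y$. Fix $\bar\varepsilon>0$, and for $c\in\mathbb R^d$ let $W(c)$ be the open cube with center $c$, side $\bar\varepsilon$ and sides parallel to the coordinate axes. All functions are real valued. Let $a_M\in L^2(\tilde\Omega)$ (a representative is fixed). *Continuous extension.* Assume $W(x)\subset\tilde\Omega$ for all $x\in\Omega$. For $x\in\Omega$ let $\tilde a(x,\cdot)$ be the $\bar\varepsilon$-periodic function on $\mathbb R^d$ with $\tilde a(x,z)=a_M(z)$ for $z\in W(x)$, and put $a(x,y)=\tilde a(x,\bar\varepsilon y)$. *Discrete extension.* Let $\overline\Omega=\bigcup_{j=1}^N\overline{\Omega_j}$, where the $\Omega_j$ are pairwise disjoint Lebesgue measurable sets that cover $\Omega$ up to a null set (as is the case when the boundaries $\partial\Omega_j$ are null sets), and let $W_j=W(\hat x^j)\subset\tilde\Omega$ be cubes with $\Omega_j\subset\overline{W_j}$. For $x\in\Omega\cap\Omega_j$ let $\tilde a(x,\cdot)$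 be the $\bar\varepsilon$-periodic function on $\mathbb R^d$ with $\tilde a(x,z)=a_M(z)$ for $z\in W_j$, and put $a(x,y)=\tilde a(x,\bar\varepsilon y)$. For the remaining $x\in\Omega$ (a null set), $a(x,\cdot)$ is an arbitrary $Y$-periodic function. In both cases the values of $a(x,\cdot)$ at the points $y$ for which $\bar\varepsilon y$ is congruent modulo $\bar\varepsilon\mathbb Z^d$ to a point on the boundary of the cube are arbitrary, subject to $Y$-periodicity. Let $(\varepsilon_n)$ be a sequence of positive numbers tending to $0$. A sequence $u_n\in L^2(\Omega)$ *two-scale converges* to $u_0\in L^2(\Omega\times Y)$ if $(u_n)$ is bounded in $L^2(\Omega)$ and, for every $\eta\in C_c^\infty(\Omega\times Y)$, extended $Y$-periodically, $$\lim_{n\to\infty}\int_\Omega u_n(x)\,\eta\Bigl(x,\frac{x}{\varepsilon_n}\Bigr)dx=\int_\Omega\int_Y u_0(x,y)\,\eta(x,y)\,dy\,dx .$$ A $Y$-periodic function $\phi$ on $\Omega\times\mathbb R^d$ that is square integrable on $\Omega\times Y$, with $x\mapsto\phi(x,x/\varepsilon_n)$ in $L^2(\Omega)$ for all $n$, is an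 *admissible test function* if for every sequence $(u_n)$ that two-scale converges to some $u_0$, $$\lim_{n\to\infty}\int_\Omega u_n(x)\,\phi\Bigl(x,\frac{x}{\varepsilon_n}\Bigr)dx=\int_\Omega\int_Y u_0(x,y)\,\phi(x,y)\,dy\,dx .$$ **Theorem.** If $a$ is the Continuous or the Discrete extension of $a_M$, and $\psi\in C(\overline\Omega\times\overline Y)$ is $Y$-periodic (that is, $\psi$ is a $Y$-periodic function on $\overline\Omega\times\mathbb R^d$ whose restriction to $\overline\Omega\times\overline Y$ is continuous), then $a(x,y)\psi(x,y)$ is an admissible test function. In particular, it is square integrable on $\Omega\times Y$, and $a(x,x/\varepsilon_n)\psi(x,x/\varepsilon_n)$ lies in $L^2(\Omega)$ for every $n$. -/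

import Mathlib

open MeasureTheory Filter Topology

namespace TwoScale

/-- The open unit cell `Y = (0,1)^d` of `ℝ^d` (realised as `Fin d → ℝ`; only its topology, its
smooth structure and Lebesgue measure are used below, so the choice of the norm is irrelevant). -/
def unitCell (d : ℕ) : Set (Fin d → ℝ) := {y | ∀ i, 0 < y i ∧ y i < 1}

/-- `Y`-periodicity of a function on `ℝ^d`, `Y = (0,1)^d`: invariance under `ℤ^d`. -/
def CellPeriodic {d : ℕ} (b : (Fin d → ℝ) → ℝ) : Prop :=
  ∀ (y : Fin d → ℝ) (k : Fin d → ℤ), b (fun i => y i + (k i : ℝ)) = b y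

/-- The open cube `W(c)` with center `c`, side `r` and sides parallel to the coordinate axes. -/
def cube {d : ℕ} (r : ℝ) (c : Fin d → ℝ) : Set (Fin d → ℝ) := {z | ∀ i, |z i - c i| < r / 2}

/-- `b(y) = b̃(r y)`, where `b̃` is the `r`-periodic function on `ℝ^d` with `b̃ = aM` in the cube
`W(c)` of side `r`. Equivalently: `b` is `Y`-periodic and `b(z / r) = aM(z)` for `z ∈ W(c)`.
Nothing is prescribed on the (Lebesgue null) grid of points whose `r`-multiples are periodic to
the faces of `W(c)`, so that every convention about the faces is covered. -/
def IsPeriodicCellExtension {d : ℕ} (r : ℝ) (aM : (Fin d → ℝ) → ℝ) (c : Fin d → ℝ)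
    (b : (Fin d → ℝ) → ℝ) : Prop :=
  CellPeriodic b ∧ ∀ z ∈ cube r c, b (r⁻¹ • z) = aM z

/-- `a(x,y)` is the Continuous two-scale extension of `aM` (with cubes of side `r`):
for every `x ∈ Ω` it is built from the values of `aM` in the cube `W(x)` around `x`. -/
def IsContinuousExtension {d : ℕ} (Ω : Set (Fin d → ℝ)) (r : ℝ) (aM : (Fin d → ℝ) → ℝ)
    (a : (Fin d → ℝ) × (Fin d → ℝ) → ℝ) : Prop :=
  ∀ x ∈ Ω, IsPeriodicCellExtension r aM x (fun y => a (x, y))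

/-- A finite partition `closure Ω = ⋃ j, closure (P j)` into pairwise disjoint Lebesgue measurable
sets `P j` which cover `Ω` up to a null set. -/
structure IsFinitePartition {d N : ℕ} (Ω : Set (Fin d → ℝ)) (P : Fin N → Set (Fin d → ℝ)) :
    Prop where
  closure_eq : closure Ω = ⋃ j, closure (P j)
  pairwise_disjoint : ∀ i j, i ≠ j → Disjoint (P i) (P j)
  nullMeasurable : ∀ j, NullMeasurableSet (P j) volume
  ae_cover : volume (Ω \ ⋃ j, P j) = 0

/-- `a(x,y)` is the Discrete two-scale extension of `aM` for the pieces `P j` and the cubes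
`W_j` with centers `c j` and side `r`: for every `x ∈ Ω ∩ P j` it is built from the values of `aM`
in `W_j`. (On the null set of those `x ∈ Ω` that lie in no piece only periodicity is asked.) -/
def IsDiscreteExtension {d N : ℕ} (Ω : Set (Fin d → ℝ)) (P : Fin N → Set (Fin d → ℝ))
    (c : Fin N → Fin d → ℝ) (r : ℝ) (aM : (Fin d → ℝ) → ℝ)
    (a : (Fin d → ℝ) × (Fin d → ℝ) → ℝ) : Prop :=
  (∀ x ∈ Ω, CellPeriodic (fun y => a (x, y))) ∧
  ∀ j, ∀ x ∈ Ω ∩ P j, IsPeriodicCellExtension r aM (c j) (fun y => a (x, y))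

/-- Test functions: smooth functions with compact support in the open set `Ω × Y`. -/
def IsTestFunction {d : ℕ} (Ω : Set (Fin d → ℝ))
    (η : (Fin d → ℝ) × (Fin d → ℝ) → ℝ) : Prop :=
  ContDiff ℝ ((⊤ : ℕ∞) : WithTop ℕ∞) η ∧ HasCompactSupport η ∧ tsupport η ⊆ Ω ×ˢ unitCell d

/-- The extension of a function on `Ω × Y` by periodic repetition in the second variable. -/
noncomputable def periodicRepetition {d : ℕ} (η : (Fin d → ℝ) × (Fin d → ℝ) → ℝ) :
    (Fin d → ℝ) × (Fin d → ℝ) → ℝ :=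
  fun p => η (p.1, fun i => Int.fract (p.2 i))

/-- Two-scale convergence in `L²(Ω)` of `u n`, along the scales `ε n`, to `u₀ ∈ L²(Ω × Y)`. -/
structure TwoScaleConverges {d : ℕ} (Ω : Set (Fin d → ℝ)) (ε : ℕ → ℝ)
    (u : ℕ → (Fin d → ℝ) → ℝ) (u₀ : (Fin d → ℝ) × (Fin d → ℝ) → ℝ) : Prop where
  memLp : ∀ n, MemLp (u n) 2 (volume.restrict Ω)
  memLp_limit : MemLp u₀ 2 (volume.restrict (Ω ×ˢ unitCell d))
  tendsto : ∀ η, IsTestFunction Ω η →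
    Tendsto (fun n => ∫ x in Ω, u n x * periodicRepetition η (x, (ε n)⁻¹ • x)) atTop
      (𝓝 (∫ p in Ω ×ˢ unitCell d, u₀ p * η p))
  bounded : ∃ C : ℝ, ∀ n, eLpNorm (u n) 2 (volume.restrict Ω) ≤ ENNReal.ofReal C

/-- Admissible test functions for two-scale convergence along the scales `ε n`. -/
structure IsAdmissible {d : ℕ} (Ω : Set (Fin d → ℝ)) (ε : ℕ → ℝ)
    (φ : (Fin d → ℝ) × (Fin d → ℝ) → ℝ) : Prop where
  periodic : ∀ x ∈ Ω, CellPeriodic (fun y => φ (x, y))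
  memLp : MemLp φ 2 (volume.restrict (Ω ×ˢ unitCell d))
  memLp_scale : ∀ n, MemLp (fun x => φ (x, (ε n)⁻¹ • x)) 2 (volume.restrict Ω)
  tendsto : ∀ u u₀, TwoScaleConverges Ω ε u u₀ →
    Tendsto (fun n => ∫ x in Ω, u n x * φ (x, (ε n)⁻¹ • x)) atTop
      (𝓝 (∫ p in Ω ×ˢ unitCell d, u₀ p * φ p))

/-- The periodic cell extension exists: choose in `W(c)` the representative of `r y`. -/
theorem exists_isPeriodicCellExtension {d : ℕ} {r : ℝ} (hr : 0 < r) (aM : (Fin d → ℝ) → ℝ)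
    (c : Fin d → ℝ) : IsPeriodicCellExtension r aM c
      (fun y => aM (fun i => c i - r / 2 + r * Int.fract (y i - c i / r + 1 / 2))) := by
  refine ⟨fun y k => ?_, fun z hz => ?_⟩
  · show aM _ = aM _
    congr 1
    funext i
    have : y i + (k i : ℝ) - c i / r + 1 / 2 = (y i - c i / r + 1 / 2) + (k i : ℝ) := by ring
    simp only [this, Int.fract_add_intCast]
  · show aM _ = aM z
    congr 1
    funext i
    have h := abs_lt.1 (hz i)
    have e : (r⁻¹ • z) i - c i / r + 1 / 2 = (z i - c i + r / 2) / r := by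
      simp only [Pi.smul_apply, smul_eq_mul]
      field_simp
    have h2 : Int.fract ((z i - c i + r / 2) / r) = (z i - c i + r / 2) / r := by
      rw [Int.fract_eq_self]
      refine ⟨div_nonneg (by linarith) hr.le, ?_⟩
      rw [div_lt_one hr]
      linarith
    rw [e, h2]
    field_simp
    ring

end TwoScale

namespace TwoScale

/-! Testing against `φ(x, x/ε n)` means integrating against the law of `x ↦ (x, {x/ε n})` on `Ω ×
[0,1)^d`; these laws and Lebesgue measure on `Ω × Y` form the family `scaleMeasure`. If test
functions approximate `φ` in `L²`, uniformly over Lebesgue measure and all late sampling measures,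
then Cauchy–Schwarz and boundedness of `u n` give admissibility (`Approximable.isAdmissible`).

For `a ψ`, wrapping the cube around the torus cuts it into finitely many pieces. On `Ω × Y` the
function is a.e. a finite sum of products of a bounded continuous weight, the indicator of a piece
`P j` in `x`, an `L²` function of `y`, and the indicator of the cell at `y + s x + t`
(`approximable_extension_mul`). Here `s = -1/r` for the Continuous extension, with `r` the side of
the cubes, and `s = 0` for the Discrete one.

The last two arguments are harmless because, modulo `ℤ^d`, sampling turns `y + s x + t` into `(1/ε n
+ s) x + t`, whose law is at most a constant times Lebesgue measure, uniformly for large `n`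
(`map_cellFract_affine_le`, `eventually_map_shear_le`). Hence each rough factor may be replaced by a
continuous compactly supported one (`Approximable.of_dense`), and the resulting product is
mollified. No continuity of `aM` is needed. -/

theorem unitCell_eq_pi (d : ℕ) : unitCell d = Set.univ.pi fun _ => Set.Ioo (0 : ℝ) 1 := by
  ext y
  simp [unitCell]

theorem isOpen_unitCell (d : ℕ) : IsOpen (unitCell d) := by
  rw [unitCell_eq_pi]
  exact isOpen_set_pi Set.finite_univ fun _ _ => isOpen_Ioo

theorem volume_unitCell (d : ℕ) : volume (unitCell d) = 1 := by
  rw [unitCell_eq_pi, Real.volume_pi_Ioo]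
  simp

theorem unitCell_subset_Icc (d : ℕ) : unitCell d ⊆ Set.Icc (fun _ => -1) (fun _ => 1) :=
  fun _ hy => ⟨fun i => by linarith [(hy i).1], fun i => (hy i).2.le⟩

theorem isCompact_closure_unitCell (d : ℕ) : IsCompact (closure (unitCell d)) :=
  isCompact_Icc.of_isClosed_subset isClosed_closure
    (closure_minimal (unitCell_subset_Icc d) isClosed_Icc)

theorem pi_Ico_ae_eq_unitCell (d : ℕ) :
    (Set.univ.pi fun _ => Set.Ico (0 : ℝ) 1) =ᵐ[volume] unitCell d := by
  rw [unitCell_eq_pi]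
  exact (Measure.univ_pi_Ico_ae_eq_Icc (μ := fun _ : Fin d => (volume : Measure ℝ))).trans
    (Measure.univ_pi_Ioo_ae_eq_Icc (μ := fun _ : Fin d => (volume : Measure ℝ))).symm

/-! ### Laws of affine maps modulo the integer lattice -/

/-- The componentwise fractional part. -/
noncomputable def cellFract {d : ℕ} (y : Fin d → ℝ) : Fin d → ℝ := fun i => Int.fract (y i)

theorem measurable_cellFract {d : ℕ} : Measurable (cellFract (d := d)) :=
  measurable_pi_lambda _ fun i => measurable_fract.comp (measurable_pi_apply i)

theorem measurable_cellFract_affine {d : ℕ} (l : ℝ) (t : Fin d → ℝ) :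
    Measurable fun x => cellFract (l • x + t) :=
  measurable_cellFract.comp ((measurable_const_smul l).add_const t)

theorem CellPeriodic.apply_cellFract {d : ℕ} {b : (Fin d → ℝ) → ℝ} (hb : CellPeriodic b)
    (y : Fin d → ℝ) : b (cellFract y) = b y := by
  rw [← hb (cellFract y) fun i => ⌊y i⌋]
  congr 1
  funext i
  exact Int.fract_add_floor (y i)

/-- The constant in the bound for the law of `x ↦ l x + t` modulo `ℤ^d`. -/
noncomputable def cellConst (d : ℕ) (R l : ℝ) : ENNReal :=
  ENNReal.ofReal (((2 * |l| * R + 2) / |l|) ^ d)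

/-- The law of `x ↦ l x + t` modulo `ℤ^d` is bounded by a multiple of Lebesgue measure. -/
theorem map_cellFract_affine_le {d : ℕ} {Ω : Set (Fin d → ℝ)} {R : ℝ} (hR : 0 ≤ R)
    (hΩ : Ω ⊆ Set.Icc (fun _ => -R) (fun _ => R)) {l : ℝ} (hl : l ≠ 0) (t : Fin d → ℝ) :
    Measure.map (fun x => cellFract (l • x + t)) (volume.restrict Ω) ≤
      cellConst d R l • volume.restrict (unitCell d) := by
  have hl' : 0 < |l| := abs_pos.2 hl
  have hmeas := measurable_cellFract_affine l t
  refine Measure.le_iff.2 fun B hB => ?_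
  rw [Measure.map_apply hmeas hB, Measure.restrict_apply (hmeas hB), Measure.smul_apply,
    Measure.restrict_apply hB, smul_eq_mul]
  set Q : Set (Fin d → ℝ) := Set.univ.pi fun _ => Set.Ico (0 : ℝ) 1 with hQ
  -- These are the possible integer parts of `l x + t` for `x` in `[-R, R]^d`. There are at most
  -- `2|l|R + 2` per coordinate, and each translate contributes a factor `|l|^(-d)` to the volume.
  set K : Finset (Fin d → ℤ) := Finset.Icc (fun i => ⌊-(|l| * R) + t i⌋)
    (fun i => ⌊|l| * R + t i⌋) with hK
  have hcover : (fun x => cellFract (l • x + t)) ⁻¹' B ∩ Ω ⊆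
      ⋃ k ∈ K, (fun x => l • x) ⁻¹' ((fun x => x + (t - fun i => (k i : ℝ))) ⁻¹' (B ∩ Q)) := by
    rintro x ⟨hx, hxΩ⟩
    have hb : ∀ i, |l * x i| ≤ |l| * R := fun i => by
      rw [abs_mul]
      exact mul_le_mul_of_nonneg_left (abs_le.2 ⟨(hΩ hxΩ).1 i, (hΩ hxΩ).2 i⟩) hl'.le
    have he : l • x + (t - fun i => ((⌊(l • x + t) i⌋ : ℤ) : ℝ)) = cellFract (l • x + t) := by
      funext i
      simp only [cellFract, Int.fract, Pi.add_apply, Pi.sub_apply]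
      ring
    refine Set.mem_iUnion₂.2 ⟨fun i => ⌊(l • x + t) i⌋, ?_, ?_⟩
    · refine Finset.mem_Icc.2 ⟨fun i => Int.floor_le_floor ?_, fun i => Int.floor_le_floor ?_⟩
      · have := (abs_le.1 (hb i)).1
        simp only [Pi.add_apply, Pi.smul_apply, smul_eq_mul]
        linarith
      · have := (abs_le.1 (hb i)).2
        simp only [Pi.add_apply, Pi.smul_apply, smul_eq_mul]
        linarith
    · refine Set.mem_preimage.2 ?_
      rw [Set.mem_preimage, he]
      exact ⟨hx, fun i _ => ⟨Int.fract_nonneg _, Int.fract_lt_one _⟩⟩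
  have hcard : (K.card : ℝ) ≤ (2 * |l| * R + 2) ^ d := by
    rw [hK, Pi.card_Icc]
    push_cast
    refine (Finset.prod_le_prod (g := fun _ => 2 * |l| * R + 2) (fun _ _ => Nat.cast_nonneg _)
      fun i _ => ?_).trans (by simp)
    have h1 : ⌊-(|l| * R) + t i⌋ ≤ ⌊|l| * R + t i⌋ + 1 := by
      have : ⌊-(|l| * R) + t i⌋ ≤ ⌊|l| * R + t i⌋ :=
        Int.floor_le_floor (by nlinarith)
      linarith
    rw [← Int.cast_natCast, Int.card_Icc_of_le _ _ h1]
    push_cast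
    linarith [Int.floor_le (|l| * R + t i), Int.lt_floor_add_one (-(|l| * R) + t i)]
  have hvol : volume (B ∩ Q) = volume (B ∩ unitCell d) :=
    measure_congr ((ae_eq_refl B).inter (pi_Ico_ae_eq_unitCell d))
  calc volume ((fun x => cellFract (l • x + t)) ⁻¹' B ∩ Ω)
      ≤ ∑ k ∈ K, volume ((fun x => l • x) ⁻¹'
          ((fun x => x + (t - fun i => (k i : ℝ))) ⁻¹' (B ∩ Q))) :=
        (measure_mono hcover).trans (measure_biUnion_finset_le _ _)
    _ = K.card * (ENNReal.ofReal |(l ^ d)⁻¹| * volume (B ∩ unitCell d)) := by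
        simp only [Measure.addHaar_preimage_smul volume hl, measure_preimage_add_right, hvol,
          Module.finrank_fin_fun, Finset.sum_const, nsmul_eq_mul]
    _ = ENNReal.ofReal (K.card * |(l ^ d)⁻¹|) * volume (B ∩ unitCell d) := by
        rw [← mul_assoc, ENNReal.ofReal_mul (Nat.cast_nonneg _), ENNReal.ofReal_natCast]
    _ ≤ cellConst d R l * volume (B ∩ unitCell d) := by
        refine mul_le_mul_left (ENNReal.ofReal_le_ofReal ?_) _
        rw [div_pow, div_eq_mul_inv, abs_inv, abs_pow]
        exact mul_le_mul_of_nonneg_right hcard (by positivity)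

/-! ### Density and Hölder estimates in `L²` -/

/-- Continuous functions with compact support in an open set of finite measure are dense in
`L²`. -/
theorem exists_continuous_tsupport_subset_eLpNorm_sub_le {d : ℕ} {U : Set (Fin d → ℝ)}
    (hU : IsOpen U) (hfin : volume U ≠ ⊤) {f : (Fin d → ℝ) → ℝ}
    (hf : MemLp f 2 (volume.restrict U)) {δ : ENNReal} (hδ : δ ≠ 0) :
    ∃ g : (Fin d → ℝ) → ℝ, Continuous g ∧ HasCompactSupport g ∧ tsupport g ⊆ U ∧
      MemLp g 2 (volume.restrict U) ∧ eLpNorm (f - g) 2 (volume.restrict U) ≤ δ := by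
  rcases eq_or_ne δ ⊤ with rfl | hδt
  · exact ⟨0, continuous_zero, HasCompactSupport.zero, by simp, MemLp.zero', le_top⟩
  obtain ⟨g, -, hfg, hg, hgm⟩ := hf.exists_hasCompactSupport_eLpNorm_sub_le (by simp)
    (ENNReal.half_pos hδ).ne'
  -- The support of `g` may leave `U`. It is cut off by `κ`, equal to `1` on a compact `K` with `U \
  -- K` so small that `g` has little `L²` mass there.
  obtain ⟨η, hη, hgη⟩ := hgm.eLpNorm_indicator_le (by norm_num) (by simp)
    (ENNReal.toReal_pos (ENNReal.half_pos hδ).ne' (ENNReal.div_ne_top hδt (by simp)))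
  obtain ⟨K, hKU, hK, hKη⟩ := hU.measurableSet.exists_isCompact_sdiff_lt hfin
    (ENNReal.ofReal_pos.2 hη).ne'
  obtain ⟨K', hK', hKK', hK'U⟩ := exists_compact_between hK hU hKU
  obtain ⟨κ, hκ1, hκ0, hκc, hκ⟩ := exists_continuous_one_zero_of_isCompact hK
    (isOpen_interior (s := K')).isClosed_compl (Set.disjoint_compl_right_iff_subset.2 hKK')
  have hκK' : tsupport κ ⊆ K' := closure_minimal
    (fun x hx => interior_subset (by_contra fun h => hx (hκ0 h))) hK'.isClosed
  have hgκ : MemLp (fun x => g x * κ x) 2 (volume.restrict U) := by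
    refine hgm.mono (hg.mul κ.continuous).aestronglyMeasurable (ae_of_all _ fun x => ?_)
    rw [norm_mul, Real.norm_of_nonneg (hκ x).1]
    exact mul_le_of_le_one_right (norm_nonneg _) (hκ x).2
  have hd : eLpNorm (g - fun x => g x * κ x) 2 (volume.restrict U) ≤ δ / 2 := by
    have hm : MeasurableSet (U \ K) := hU.measurableSet.diff hK.measurableSet
    have hle : volume.restrict U (U \ K) ≤ ENNReal.ofReal η :=
      (Measure.restrict_apply_le _ _).trans hKη.le
    refine (eLpNorm_mono_ae ?_).trans ((hgη _ hm hle).trans (ENNReal.ofReal_toReal_le))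
    filter_upwards [ae_restrict_mem hU.measurableSet] with x hx
    by_cases hxK : x ∈ K
    · simp [hκ1 hxK, hxK]
    · rw [Set.indicator_of_mem (show x ∈ U \ K from ⟨hx, hxK⟩), Pi.sub_apply, ← mul_one_sub, norm_mul,
        Real.norm_of_nonneg (sub_nonneg.2 (hκ x).2)]
      exact mul_le_of_le_one_right (norm_nonneg _) (by linarith [(hκ x).1])
  refine ⟨fun x => g x * κ x, hg.mul κ.continuous, hκc.mul_left, ?_, hgκ, ?_⟩
  · exact (closure_mono (Function.support_mul_subset_right _ _)).trans (hκK'.trans hK'U)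
  · calc eLpNorm (f - fun x => g x * κ x) 2 (volume.restrict U)
        = eLpNorm ((f - g) + (g - fun x => g x * κ x)) 2 (volume.restrict U) := by
          rw [sub_add_sub_cancel]
      _ ≤ δ / 2 + δ / 2 := (eLpNorm_add_le (hf.sub hgm).1 (hgm.sub hgκ).1 (by norm_num)).trans
          (add_le_add hfg hd)
      _ = δ := ENNReal.add_halves δ

/-- The smooth approximation can be taken with support inside that of `f`, so the support condition
survives. -/
theorem exists_isTestFunction_dist_lt {d : ℕ} {Ω : Set (Fin d → ℝ)}
    {f : (Fin d → ℝ) × (Fin d → ℝ) → ℝ} (hf : Continuous f) (hc : HasCompactSupport f)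
    (hs : tsupport f ⊆ Ω ×ˢ unitCell d) {δ : ℝ} (hδ : 0 < δ) :
    ∃ η, IsTestFunction Ω η ∧ ∀ p, ‖(f - η) p‖ ≤ δ := by
  obtain ⟨η, hη, hd, hsupp⟩ := hf.exists_contDiff_approx ⊤ (continuous_const (y := δ))
    fun _ => hδ
  refine ⟨η, ⟨hη, hc.mono hsupp, (closure_mono hsupp).trans hs⟩, fun p => ?_⟩
  rw [Pi.sub_apply, ← dist_eq_norm, dist_comm]
  exact (hd p).le

/-- Cauchy–Schwarz applied to `f (g - h)`. -/
theorem abs_integral_mul_sub_integral_mul_le {α : Type*} [MeasurableSpace α] {μ : Measure α}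
    {f g h : α → ℝ} (hf : MemLp f 2 μ) (hg : MemLp g 2 μ) (hh : MemLp h 2 μ) {a b : ℝ}
    (ha : 0 ≤ a) (hb : 0 ≤ b) (hfa : eLpNorm f 2 μ ≤ ENNReal.ofReal a)
    (hgb : eLpNorm (g - h) 2 μ ≤ ENNReal.ofReal b) :
    |(∫ x, f x * g x ∂μ) - ∫ x, f x * h x ∂μ| ≤ a * b := by
  have hsub : (∫ x, f x * g x ∂μ) - ∫ x, f x * h x ∂μ = ∫ x, f x * (g - h) x ∂μ := by
    simp only [Pi.sub_apply, mul_sub]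
    exact (integral_sub (hf.integrable_mul hg) (hf.integrable_mul hh)).symm
  rw [hsub, ← ENNReal.ofReal_le_ofReal_iff (by positivity), ← Real.enorm_eq_ofReal_abs]
  calc ‖∫ x, f x * (g - h) x ∂μ‖ₑ ≤ ∫⁻ x, ‖(f • (g - h)) x‖ₑ ∂μ :=
        enorm_integral_le_lintegral_enorm _
    _ = eLpNorm (f • (g - h)) 1 μ := eLpNorm_one_eq_lintegral_enorm.symm
    _ ≤ eLpNorm f 2 μ * eLpNorm (g - h) 2 μ := eLpNorm_smul_le_mul_eLpNorm (hg.sub hh).1 hf.1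
    _ ≤ ENNReal.ofReal a * ENNReal.ofReal b := mul_le_mul' hfa hgb
    _ = ENNReal.ofReal (a * b) := (ENNReal.ofReal_mul ha).symm

theorem eLpNorm_comp_le_of_map_le {α β : Type*} [MeasurableSpace α] [MeasurableSpace β]
    {μ : Measure α} {ν : Measure β} {T : α → β} (hT : Measurable T) {C : ENNReal} (hC : C ≠ ⊤)
    (h : μ.map T ≤ C • ν) {f : β → ℝ} (hf : MemLp f 2 ν) :
    MemLp (f ∘ T) 2 μ ∧ eLpNorm (f ∘ T) 2 μ ≤ C ^ (1 / 2 : ℝ) * eLpNorm f 2 ν := by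
  have hm : MemLp f 2 (μ.map T) := hf.of_measure_le_smul hC h
  refine ⟨(memLp_map_measure_iff hm.1 hT.aemeasurable).1 hm, ?_⟩
  rw [← eLpNorm_map_measure hm.1 hT.aemeasurable]
  refine (eLpNorm_mono_measure f h).trans_eq ?_
  rw [eLpNorm_smul_measure_of_ne_top (by simp)]
  simp

/-! ### Sampling measures and their images under shears -/

/-- The points of `Ω × [0,1)^d` at which a two-scale function is sampled at the scale `r`. -/
noncomputable def scaleMap {d : ℕ} (r : ℝ) (x : Fin d → ℝ) : (Fin d → ℝ) × (Fin d → ℝ) :=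
  (x, cellFract (r⁻¹ • x))

theorem measurable_scaleMap {d : ℕ} (r : ℝ) : Measurable (scaleMap (d := d) r) :=
  measurable_id.prodMk (measurable_cellFract.comp (measurable_const_smul _))

/-- The sampling measures at the scales `ε n`, together with Lebesgue measure on `Ω × Y` as the
member of index `none`. -/
noncomputable def scaleMeasure {d : ℕ} (Ω : Set (Fin d → ℝ)) (ε : ℕ → ℝ) :
    Option ℕ → Measure ((Fin d → ℝ) × (Fin d → ℝ))
  | none => volume.restrict (Ω ×ˢ unitCell d)
  | some n => (volume.restrict Ω).map (scaleMap (ε n))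

/-- `P i` holds eventually along this filter iff `P none` holds, and `P (some n)` holds for all
large `n`. -/
def scaleFilter : Filter (Option ℕ) := pure none ⊔ map some atTop

theorem scaleMeasure_none {d : ℕ} (Ω : Set (Fin d → ℝ)) (ε : ℕ → ℝ) :
    scaleMeasure Ω ε none = (volume.restrict Ω).prod (volume.restrict (unitCell d)) := by
  rw [Measure.prod_restrict]
  rfl

/-- Functions that test functions approximate in `L²`, uniformly along the sampling measures. -/
structure Approximable {d : ℕ} (Ω : Set (Fin d → ℝ)) (ε : ℕ → ℝ)
    (φ : (Fin d → ℝ) × (Fin d → ℝ) → ℝ) : Prop where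
  memLp : ∀ i, MemLp φ 2 (scaleMeasure Ω ε i)
  approx : ∀ δ : ENNReal, δ ≠ 0 → ∃ η, IsTestFunction Ω η ∧
    ∀ᶠ i in scaleFilter, eLpNorm (φ - η) 2 (scaleMeasure Ω ε i) ≤ δ

variable {d : ℕ} {Ω : Set (Fin d → ℝ)} {ε : ℕ → ℝ}

theorem map_fst_scaleMeasure_le (i : Option ℕ) :
    (scaleMeasure Ω ε i).map Prod.fst ≤ volume.restrict Ω := by
  cases i with
  | none =>
    rw [scaleMeasure_none, Measure.map_fst_prod, Measure.restrict_apply_univ, volume_unitCell,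
      one_smul]
  | some n =>
    rw [scaleMeasure, Measure.map_map measurable_fst (measurable_scaleMap _)]
    exact (Measure.map_id (μ := volume.restrict Ω)).le

theorem scaleMeasure_univ_le (i : Option ℕ) : scaleMeasure Ω ε i Set.univ ≤ volume Ω := by
  have h := map_fst_scaleMeasure_le (Ω := Ω) (ε := ε) i Set.univ
  rwa [Measure.map_apply measurable_fst MeasurableSet.univ, Set.preimage_univ,
    Measure.restrict_apply_univ] at h

theorem isFiniteMeasure_scaleMeasure (hfin : volume Ω ≠ ⊤) (i : Option ℕ) :
    IsFiniteMeasure (scaleMeasure Ω ε i) :=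
  ⟨(scaleMeasure_univ_le i).trans_lt hfin.lt_top⟩

/-- The position of `y + s x + t` in the unit cell, where `p = (x, y)`. -/
noncomputable def shear {d : ℕ} (s : ℝ) (t : Fin d → ℝ) (p : (Fin d → ℝ) × (Fin d → ℝ)) :
    Fin d → ℝ := cellFract (p.2 + (s • p.1 + t))

theorem measurable_shear (s : ℝ) (t : Fin d → ℝ) : Measurable (shear s t) :=
  measurable_cellFract.comp (by fun_prop)

/-- Replacing `x/r` by its fractional part changes the argument by an integer vector, so under
sampling the shear is an affine function of `x` alone, modulo `ℤ^d`. -/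
theorem shear_scaleMap (s : ℝ) (t : Fin d → ℝ) (r : ℝ) (x : Fin d → ℝ) :
    shear s t (scaleMap r x) = cellFract ((r⁻¹ + s) • x + t) := by
  funext i
  simp only [shear, scaleMap, cellFract, Pi.add_apply, Pi.smul_apply, smul_eq_mul]
  rw [Int.fract_eq_fract]
  exact ⟨-⌊r⁻¹ * x i⌋, by push_cast; rw [Int.fract]; ring⟩

/-- By Fubini: for fixed `x` the shear is a translation of `Y ⊆ [-1,1]^d` modulo `ℤ^d`, which is the
affine bound with `R = l = 1`. -/
theorem map_shear_none_le (s : ℝ) (t : Fin d → ℝ) :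
    (scaleMeasure Ω ε none).map (shear s t) ≤
      (cellConst d 1 1 * volume Ω) • volume.restrict (unitCell d) := by
  refine Measure.le_iff.2 fun B hB => ?_
  have hm := measurable_shear s t
  rw [Measure.map_apply hm hB, scaleMeasure_none, Measure.prod_apply (hm hB)]
  calc ∫⁻ x, volume.restrict (unitCell d) (Prod.mk x ⁻¹' (shear s t ⁻¹' B)) ∂volume.restrict Ω
      ≤ ∫⁻ _, cellConst d 1 1 * volume.restrict (unitCell d) B ∂volume.restrict Ω := by
        refine lintegral_mono fun x => ?_
        have h := map_cellFract_affine_le zero_le_one (unitCell_subset_Icc d) one_ne_zero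
          (s • x + t) B
        rw [Measure.map_apply (measurable_cellFract_affine _ _) hB] at h
        simp only [one_smul] at h
        refine le_of_eq_of_le (congrArg _ (Set.ext fun y => ?_)) h
        simp [shear]
    _ = _ := by
        rw [lintegral_const, Measure.restrict_apply_univ, Measure.smul_apply, smul_eq_mul]
        ring

theorem map_shear_some_le {R : ℝ} (hR : 0 ≤ R)
    (hΩ : Ω ⊆ Set.Icc (fun _ => -R) (fun _ => R)) {s : ℝ} {n : ℕ} (hs : (ε n)⁻¹ + s ≠ 0)
    (t : Fin d → ℝ) :
    (scaleMeasure Ω ε (some n)).map (shear s t) ≤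
      cellConst d R ((ε n)⁻¹ + s) • volume.restrict (unitCell d) := by
  rw [scaleMeasure, Measure.map_map (measurable_shear s t) (measurable_scaleMap _)]
  refine le_trans (le_of_eq ?_) (map_cellFract_affine_le hR hΩ hs t)
  congr 1
  exact funext fun x => shear_scaleMap s t _ x

theorem exists_forall_subset_Icc (hb : Bornology.IsBounded Ω) :
    ∃ R : ℝ, 0 ≤ R ∧ Ω ⊆ Set.Icc (fun _ => -R) (fun _ => R) := by
  obtain ⟨R, hR⟩ := hb.subset_closedBall 0
  refine ⟨max R 0, le_max_right _ _, fun x hx => ?_⟩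
  have hx' : ‖x‖ ≤ max R 0 := by simpa using (hR hx).trans (le_max_left R 0)
  have hi := fun i => abs_le.1 ((norm_le_pi_norm x i).trans hx')
  exact ⟨fun i => (hi i).1, fun i => (hi i).2⟩

theorem eventually_map_shear_le (hb : Bornology.IsBounded Ω) (hεpos : ∀ n, 0 < ε n)
    (hε : Tendsto ε atTop (𝓝 0)) (s : ℝ) (t : Fin d → ℝ) :
    ∃ C : ENNReal, C ≠ ⊤ ∧ ∀ᶠ i in scaleFilter,
      (scaleMeasure Ω ε i).map (shear s t) ≤ C • volume.restrict (unitCell d) := by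
  obtain ⟨R, hR, hΩ⟩ := exists_forall_subset_Icc hb
  -- Once `l = 1/ε n + s ≥ 1`, one has `(2lR + 2)/l ≤ 2R + 2`, so the second term bounds all late
  -- sampling measures.
  refine ⟨max (cellConst d 1 1 * volume Ω) (ENNReal.ofReal ((2 * R + 2) ^ d)), ?_, ?_⟩
  · exact (max_lt (ENNReal.mul_lt_top ENNReal.ofReal_lt_top hb.measure_lt_top)
      ENNReal.ofReal_lt_top).ne
  have hmono : ∀ {C C' : ENNReal}, C ≤ C' →
      C • volume.restrict (unitCell d) ≤ C' • volume.restrict (unitCell d) := fun h =>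
    Measure.le_iff.2 fun B _ => mul_le_mul_left h _
  refine eventually_sup.2 ⟨eventually_pure.2 ((map_shear_none_le s t).trans
    (hmono (le_max_left _ _))), ?_⟩
  have hlim : Tendsto (fun n => (ε n)⁻¹ + s) atTop atTop :=
    tendsto_atTop_add_const_right _ _ (tendsto_inv_nhdsGT_zero.comp
      (tendsto_nhdsWithin_iff.2 ⟨hε, Eventually.of_forall hεpos⟩))
  refine eventually_map.2 ((hlim.eventually_ge_atTop 1).mono fun n hn => ?_)
  have h0 : 0 < (ε n)⁻¹ + s := zero_lt_one.trans_le hn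
  refine (map_shear_some_le hR hΩ h0.ne' t).trans (hmono (le_trans ?_ (le_max_right _ _)))
  refine ENNReal.ofReal_le_ofReal (pow_le_pow_left₀ (by positivity) ?_ d)
  rw [abs_of_pos h0, div_le_iff₀ h0]
  nlinarith

/-- Some coordinate of `x/ε n` is an integer only on a null set, by domination of the law by
Lebesgue measure on the open cell. -/
theorem ae_mem_scaleMeasure (hΩ : IsOpen Ω) (hb : Bornology.IsBounded Ω)
    (hεpos : ∀ n, 0 < ε n) (i : Option ℕ) :
    ∀ᵐ p ∂scaleMeasure Ω ε i, p ∈ Ω ×ˢ unitCell d := by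
  cases i with
  | none => exact ae_restrict_mem (hΩ.prod (isOpen_unitCell d)).measurableSet
  | some n =>
    have hU := (isOpen_unitCell d).measurableSet
    obtain ⟨R, hR, hΩR⟩ := exists_forall_subset_Icc hb
    have h := map_cellFract_affine_le hR hΩR (inv_pos.2 (hεpos n)).ne' (0 : Fin d → ℝ)
    have h1 : ∀ᵐ y ∂(volume.restrict Ω).map fun x => cellFract ((ε n)⁻¹ • x + 0),
        y ∈ unitCell d :=
      (Measure.absolutelyContinuous_of_le_smul h).ae_le (ae_restrict_mem hU)
    have h1 := (ae_map_iff (measurable_cellFract_affine _ _).aemeasurable hU).1 h1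
    refine (ae_map_iff (measurable_scaleMap _).aemeasurable (hΩ.measurableSet.prod hU)).2 ?_
    filter_upwards [ae_restrict_mem hΩ.measurableSet, h1] with x hx hx1
    exact ⟨hx, by rwa [add_zero] at hx1⟩

/-- This makes the law of `y` the special case `s = 0`, `t = 0` of the shear bounds. -/
theorem snd_ae_eq_shear (hΩ : IsOpen Ω) (hb : Bornology.IsBounded Ω)
    (hεpos : ∀ n, 0 < ε n) (i : Option ℕ) :
    Prod.snd =ᵐ[scaleMeasure Ω ε i] shear 0 0 := by
  filter_upwards [ae_mem_scaleMeasure hΩ hb hεpos i] with p hp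
  funext j
  have hj := hp.2 j
  simpa [shear, cellFract] using (Int.fract_eq_self.2 ⟨hj.1.le, hj.2⟩).symm

theorem exists_map_snd_le (hΩ : IsOpen Ω) (hb : Bornology.IsBounded Ω)
    (hεpos : ∀ n, 0 < ε n) (i : Option ℕ) :
    ∃ C : ENNReal, C ≠ ⊤ ∧
      (scaleMeasure Ω ε i).map Prod.snd ≤ C • volume.restrict (unitCell d) := by
  rw [Measure.map_congr (snd_ae_eq_shear hΩ hb hεpos i)]
  cases i with
  | none =>
    exact ⟨_, ENNReal.mul_ne_top ENNReal.ofReal_ne_top hb.measure_lt_top.ne,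
      map_shear_none_le 0 0⟩
  | some n =>
    obtain ⟨R, hR, hΩR⟩ := exists_forall_subset_Icc hb
    exact ⟨_, ENNReal.ofReal_ne_top,
      map_shear_some_le hR hΩR (by simpa using (hεpos n).ne') 0⟩

theorem eventually_map_snd_le (hΩ : IsOpen Ω) (hb : Bornology.IsBounded Ω)
    (hεpos : ∀ n, 0 < ε n) (hε : Tendsto ε atTop (𝓝 0)) :
    ∃ C : ENNReal, C ≠ ⊤ ∧ ∀ᶠ i in scaleFilter,
      (scaleMeasure Ω ε i).map Prod.snd ≤ C • volume.restrict (unitCell d) := by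
  obtain ⟨C, hC, h⟩ := eventually_map_shear_le (d := d) hb hεpos hε 0 0
  refine ⟨C, hC, h.mono fun i hi => ?_⟩
  rwa [Measure.map_congr (snd_ae_eq_shear hΩ hb hεpos i)]

/-! ### Approximable functions and admissibility -/

namespace Approximable

theorem of_approximable {φ : (Fin d → ℝ) × (Fin d → ℝ) → ℝ}
    (hφ : ∀ i, MemLp φ 2 (scaleMeasure Ω ε i))
    (h : ∀ δ : ENNReal, δ ≠ 0 → ∃ φ', Approximable Ω ε φ' ∧
      ∀ᶠ i in scaleFilter, eLpNorm (φ - φ') 2 (scaleMeasure Ω ε i) ≤ δ) :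
    Approximable Ω ε φ := by
  refine ⟨hφ, fun δ hδ => ?_⟩
  obtain ⟨φ', hφ', h1⟩ := h (δ / 2) (ENNReal.half_pos hδ).ne'
  obtain ⟨η, hη, h2⟩ := hφ'.approx (δ / 2) (ENNReal.half_pos hδ).ne'
  refine ⟨η, hη, ?_⟩
  filter_upwards [h1, h2] with i hi1 hi2
  rw [← sub_add_sub_cancel φ φ' η, ← ENNReal.add_halves δ]
  exact (eLpNorm_add_le ((hφ i).sub (hφ'.memLp i)).1
    ((hφ'.memLp i).1.sub hη.1.continuous.aestronglyMeasurable) (by norm_num)).trans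
    (add_le_add hi1 hi2)

theorem zero : Approximable Ω ε 0 :=
  ⟨fun _ => MemLp.zero, fun _ _ => ⟨0, ⟨contDiff_const, HasCompactSupport.zero, by simp⟩,
    Eventually.of_forall fun _ => by simp⟩⟩

theorem add {φ φ' : (Fin d → ℝ) × (Fin d → ℝ) → ℝ} (h : Approximable Ω ε φ)
    (h' : Approximable Ω ε φ') : Approximable Ω ε (φ + φ') := by
  refine ⟨fun i => (h.memLp i).add (h'.memLp i), fun δ hδ => ?_⟩
  obtain ⟨η, hη, h1⟩ := h.approx (δ / 2) (ENNReal.half_pos hδ).ne'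
  obtain ⟨η', hη', h2⟩ := h'.approx (δ / 2) (ENNReal.half_pos hδ).ne'
  refine ⟨η + η', ⟨hη.1.add hη'.1, hη.2.1.add hη'.2.1,
    (tsupport_add η η').trans (Set.union_subset hη.2.2 hη'.2.2)⟩, ?_⟩
  filter_upwards [h1, h2] with i hi1 hi2
  rw [add_sub_add_comm, ← ENNReal.add_halves δ]
  exact (eLpNorm_add_le ((h.memLp i).1.sub hη.1.continuous.aestronglyMeasurable)
    ((h'.memLp i).1.sub hη'.1.continuous.aestronglyMeasurable) (by norm_num)).trans
    (add_le_add hi1 hi2)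

theorem sum {ι : Type*} {φ : ι → (Fin d → ℝ) × (Fin d → ℝ) → ℝ} (s : Finset ι)
    (h : ∀ k ∈ s, Approximable Ω ε (φ k)) : Approximable Ω ε (∑ k ∈ s, φ k) :=
  Finset.sum_induction φ (Approximable Ω ε) (fun _ _ => add) zero h

theorem congr_ae {φ φ' : (Fin d → ℝ) × (Fin d → ℝ) → ℝ} (h : Approximable Ω ε φ)
    (he : ∀ i, φ =ᵐ[scaleMeasure Ω ε i] φ') : Approximable Ω ε φ' := by
  refine ⟨fun i => (memLp_congr_ae (he i)).1 (h.memLp i), fun δ hδ => ?_⟩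
  obtain ⟨η, hη, h1⟩ := h.approx δ hδ
  refine ⟨η, hη, h1.mono fun i hi => ?_⟩
  rwa [← eLpNorm_congr_ae ((he i).sub (ae_eq_refl η))]

/-- All sampling measures have mass at most `|Ω|`, so a uniform approximation is an `L²`
approximation uniformly in the index. -/
theorem of_continuous (hfin : volume Ω ≠ ⊤) {φ : (Fin d → ℝ) × (Fin d → ℝ) → ℝ}
    (hφ : Continuous φ) (hc : HasCompactSupport φ) (hs : tsupport φ ⊆ Ω ×ˢ unitCell d) :
    Approximable Ω ε φ := by
  have hfm := isFiniteMeasure_scaleMeasure (ε := ε) hfin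
  refine ⟨fun i => ?_, fun δ hδ => ?_⟩
  · obtain ⟨C, hC⟩ := hφ.bounded_above_of_compact_support hc
    exact MemLp.of_bound hφ.aestronglyMeasurable C (ae_of_all _ hC)
  obtain ⟨r, hr, hrδ⟩ : ∃ r : ℝ, 0 < r ∧
      volume Ω ^ (2 : ENNReal).toReal⁻¹ * ENNReal.ofReal r ≤ δ := by
    have hV : volume Ω ^ (2 : ENNReal).toReal⁻¹ ≠ ⊤ :=
      ENNReal.rpow_ne_top_of_nonneg (by positivity) hfin
    have hlim : Tendsto (fun r : ℝ => volume Ω ^ (2 : ENNReal).toReal⁻¹ * ENNReal.ofReal r)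
        (𝓝[>] 0) (𝓝 0) := by
      have := ENNReal.Tendsto.const_mul (a := volume Ω ^ (2 : ENNReal).toReal⁻¹)
        (ENNReal.tendsto_ofReal (tendsto_nhdsWithin_of_tendsto_nhds
          (tendsto_id (α := ℝ) (x := 𝓝 0)) (s := Set.Ioi 0))) (Or.inr hV)
      simpa using this
    obtain ⟨r, hr1, hr2⟩ := ((hlim.eventually (Iic_mem_nhds (pos_iff_ne_zero.2 hδ))).and
      self_mem_nhdsWithin).exists
    exact ⟨r, hr2, hr1⟩
  obtain ⟨η, hη, hd⟩ := exists_isTestFunction_dist_lt hφ hc hs hr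
  refine ⟨η, hη, Eventually.of_forall fun i => ?_⟩
  refine (eLpNorm_le_of_ae_bound (ae_of_all _ hd)).trans (le_trans ?_ hrδ)
  exact mul_le_mul_left (ENNReal.rpow_le_rpow (scaleMeasure_univ_le i) (by positivity)) _

/-- It suffices to consider continuous functions with compact support in place of an `L²` factor
whose variable has a law that is bounded by Lebesgue measure. -/
theorem of_dense (hΩ : IsOpen Ω) (hb : Bornology.IsBounded Ω) (hεpos : ∀ n, 0 < ε n)
    {φ : (Fin d → ℝ) × (Fin d → ℝ) → ℝ} (hφ : ∀ i, MemLp φ 2 (scaleMeasure Ω ε i))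
    {U : Set (Fin d → ℝ)} (hU : IsOpen U) (hUfin : volume U ≠ ⊤) {f : (Fin d → ℝ) → ℝ}
    (hf : MemLp f 2 (volume.restrict U)) {T : (Fin d → ℝ) × (Fin d → ℝ) → Fin d → ℝ}
    (hT : Measurable T)
    (hTC : ∃ C : ENNReal, C ≠ ⊤ ∧ ∀ᶠ i in scaleFilter,
      (scaleMeasure Ω ε i).map T ≤ C • volume.restrict U) (M : ℝ)
    (H : ∀ f' : (Fin d → ℝ) → ℝ, Continuous f' → HasCompactSupport f' → tsupport f' ⊆ U →
      ∃ φ', Approximable Ω ε φ' ∧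
        ∀ p ∈ Ω ×ˢ unitCell d, |φ p - φ' p| ≤ M * |f (T p) - f' (T p)|) :
    Approximable Ω ε φ := by
  obtain ⟨C, hC, hTC⟩ := hTC
  refine of_approximable hφ fun δ hδ => ?_
  set A : ENNReal := ENNReal.ofReal M * C ^ (1 / 2 : ℝ) with hA
  have hAt : A ≠ ⊤ := ENNReal.mul_ne_top ENNReal.ofReal_ne_top
    (ENNReal.rpow_ne_top_of_nonneg (by positivity) hC)
  obtain ⟨r, hr, hrδ⟩ : ∃ r : ENNReal, r ≠ 0 ∧ A * r ≤ δ := by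
    -- The added `1` covers the case `A = 0`.
    refine ⟨δ / (A + 1), (ENNReal.div_pos hδ (ENNReal.add_ne_top.2 ⟨hAt, by simp⟩)).ne', ?_⟩
    rw [← mul_div_assoc, ENNReal.div_le_iff (by simp) (ENNReal.add_ne_top.2 ⟨hAt, by simp⟩),
      mul_comm]
    exact mul_le_mul_right le_self_add _
  obtain ⟨f', hf'c, hf's, hf'U, hf', hff'⟩ :=
    exists_continuous_tsupport_subset_eLpNorm_sub_le hU hUfin hf hr
  obtain ⟨φ', hφ', hle⟩ := H f' hf'c hf's hf'U
  refine ⟨φ', hφ', hTC.mono fun i hi => ?_⟩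
  have h1 : eLpNorm (φ - φ') 2 (scaleMeasure Ω ε i) ≤
      ENNReal.ofReal M * eLpNorm ((f - f') ∘ T) 2 (scaleMeasure Ω ε i) :=
    eLpNorm_le_mul_eLpNorm_of_ae_le_mul
      ((ae_mem_scaleMeasure hΩ hb hεpos i).mono fun p hp => hle p hp) 2
  refine h1.trans (le_trans ?_ hrδ)
  rw [hA, mul_assoc]
  exact mul_le_mul_right ((eLpNorm_comp_le_of_map_le hT hC hi (hf.sub hf')).2.trans
    (mul_le_mul_right hff' _)) _

/-- Exchanging `φ` for a test function `η` costs at most `D r` in the sampled integrals and in the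
limit integral, where `D` bounds all `u n` and `u₀` in `L²`; for `η` convergence is the definition.
-/
theorem isAdmissible {φ : (Fin d → ℝ) × (Fin d → ℝ) → ℝ} (h : Approximable Ω ε φ)
    (hΩ : IsOpen Ω) (hper : ∀ x ∈ Ω, CellPeriodic fun y => φ (x, y)) :
    IsAdmissible Ω ε φ := by
  have hae : ∀ n, φ ∘ scaleMap (ε n) =ᵐ[volume.restrict Ω] fun x => φ (x, (ε n)⁻¹ • x) :=
    fun n => (ae_restrict_mem hΩ.measurableSet).mono fun x hx => (hper x hx).apply_cellFract _
  have hcomp : ∀ n, ∀ f : (Fin d → ℝ) × (Fin d → ℝ) → ℝ, MemLp f 2 (scaleMeasure Ω ε (some n)) →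
      MemLp (f ∘ scaleMap (ε n)) 2 (volume.restrict Ω) ∧
        eLpNorm (f ∘ scaleMap (ε n)) 2 (volume.restrict Ω) =
          eLpNorm f 2 (scaleMeasure Ω ε (some n)) := fun n f hf =>
    ⟨(memLp_map_measure_iff hf.1 (measurable_scaleMap _).aemeasurable).1 hf,
      (eLpNorm_map_measure hf.1 (measurable_scaleMap _).aemeasurable).symm⟩
  refine ⟨hper, h.memLp none, fun n => (memLp_congr_ae (hae n)).1 (hcomp n φ (h.memLp _)).1,
    fun u u₀ hu => ?_⟩
  obtain ⟨C, hC⟩ := hu.bounded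
  set D : ℝ := max (max C (eLpNorm u₀ 2 (volume.restrict (Ω ×ˢ unitCell d))).toReal) 0 with hD
  have hD0 : 0 ≤ D := le_max_right _ _
  have huD : ∀ n, eLpNorm (u n) 2 (volume.restrict Ω) ≤ ENNReal.ofReal D := fun n =>
    (hC n).trans (ENNReal.ofReal_le_ofReal ((le_max_left _ _).trans (le_max_left _ _)))
  have hu₀D : eLpNorm u₀ 2 (volume.restrict (Ω ×ˢ unitCell d)) ≤ ENNReal.ofReal D :=
    (ENNReal.le_ofReal_iff_toReal_le hu.memLp_limit.2.ne hD0).2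
      ((le_max_right _ _).trans (le_max_left _ _))
  refine Metric.tendsto_atTop'.2 fun δ hδ => ?_
  -- Both exchanges and the convergence for `η` then cost at most `δ/4` each.
  set r : ℝ := δ / (4 * (D + 1)) with hr
  have hr0 : 0 < r := by positivity
  have hDr : D * r ≤ δ / 4 := by
    rw [hr, mul_div_assoc', div_le_div_iff₀ (by positivity) (by norm_num)]
    nlinarith
  obtain ⟨η, hη, hev⟩ := h.approx (ENNReal.ofReal r) (ENNReal.ofReal_pos.2 hr0).ne'
  obtain ⟨hnone, hsome⟩ := eventually_sup.1 hev
  have hnone := eventually_pure.1 hnone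
  have hηc := hη.1.continuous
  have hdiff : ∀ i, eLpNorm (φ - η) 2 (scaleMeasure Ω ε i) ≤ ENNReal.ofReal r →
      MemLp (φ - η) 2 (scaleMeasure Ω ε i) := fun i hi =>
    ⟨(h.memLp i).1.sub hηc.aestronglyMeasurable, hi.trans_lt ENNReal.ofReal_lt_top⟩
  have hηL : ∀ i, eLpNorm (φ - η) 2 (scaleMeasure Ω ε i) ≤ ENNReal.ofReal r →
      MemLp η 2 (scaleMeasure Ω ε i) := fun i hi => by
    simpa using (h.memLp i).sub (hdiff i hi)
  obtain ⟨N, hN⟩ := eventually_atTop.1 ((eventually_map.1 hsome).and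
    ((Metric.tendsto_nhds.1 (hu.tendsto η hη)) (δ / 4) (by positivity)))
  refine ⟨N, fun n hn => ?_⟩
  obtain ⟨hn1, hn2⟩ := hN n hn.le
  have e1 : |(∫ x in Ω, u n x * φ (x, (ε n)⁻¹ • x)) -
      ∫ x in Ω, u n x * periodicRepetition η (x, (ε n)⁻¹ • x)| ≤ D * r := by
    have e : ∫ x in Ω, u n x * φ (x, (ε n)⁻¹ • x) = ∫ x in Ω, u n x * (φ ∘ scaleMap (ε n)) x :=
      integral_congr_ae ((hae n).mono fun x hx => by simp only [hx])
    rw [e]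
    exact abs_integral_mul_sub_integral_mul_le (hu.memLp n) (hcomp n φ (h.memLp _)).1
      (hcomp n η (hηL _ hn1)).1 hD0 hr0.le (huD n) ((hcomp n (φ - η) (hdiff _ hn1)).2.trans_le hn1)
  have e2 : |(∫ p in Ω ×ˢ unitCell d, u₀ p * φ p) - ∫ p in Ω ×ˢ unitCell d, u₀ p * η p| ≤
      D * r :=
    abs_integral_mul_sub_integral_mul_le hu.memLp_limit (h.memLp none) (hηL none hnone) hD0 hr0.le
      hu₀D hnone
  rw [Real.dist_eq] at hn2 ⊢
  rw [abs_le] at e1 e2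
  rw [abs_lt] at hn2 ⊢
  constructor <;> linarith [e1.1, e1.2, e2.1, e2.2, hn2.1, hn2.2]

end Approximable

/-! ### Products with a sheared factor -/

/-- A product of a function of `(x, y)`, a function of `x`, a function of `y` and a function of
`y + s x + t`. -/
def shearProduct {d : ℕ} (w : (Fin d → ℝ) × (Fin d → ℝ) → ℝ) (f g h : (Fin d → ℝ) → ℝ) (s : ℝ)
    (t : Fin d → ℝ) (p : (Fin d → ℝ) × (Fin d → ℝ)) : ℝ :=
  w p * f p.1 * g p.2 * h (p.2 + (s • p.1 + t))

theorem abs_mul_le_mul {x y a b : ℝ} (hx : |x| ≤ a) (hy : |y| ≤ b) : |x * y| ≤ a * b := by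
  rw [abs_mul]
  exact mul_le_mul hx hy (abs_nonneg _) ((abs_nonneg _).trans hx)

/-- Every factor except `g` is bounded, so the product is dominated by a multiple of `g(y)`, and the
law of `y` is dominated by Lebesgue measure. -/
theorem memLp_shearProduct (hΩ : IsOpen Ω) (hb : Bornology.IsBounded Ω) (hεpos : ∀ n, 0 < ε n)
    {w : (Fin d → ℝ) × (Fin d → ℝ) → ℝ} (hw : Measurable w) {M : ℝ} (hM : ∀ p, |w p| ≤ M)
    {f g h : (Fin d → ℝ) → ℝ} (hf : MemLp f 2 (volume.restrict Ω)) {A : ℝ} (hA : ∀ x, |f x| ≤ A)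
    (hg : MemLp g 2 (volume.restrict (unitCell d))) (hh : Measurable h) {B : ℝ}
    (hB : ∀ x, |h x| ≤ B) (s : ℝ) (t : Fin d → ℝ) (i : Option ℕ) :
    MemLp (shearProduct w f g h s t) 2 (scaleMeasure Ω ε i) := by
  obtain ⟨C, hC, hsnd⟩ := exists_map_snd_le (ε := ε) hΩ hb hεpos i
  have hg' := (eLpNorm_comp_le_of_map_le measurable_snd hC hsnd hg).1
  have hf' := (eLpNorm_comp_le_of_map_le measurable_fst ENNReal.one_ne_top
    ((map_fst_scaleMeasure_le (ε := ε) i).trans_eq (one_smul _ _).symm) hf).1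
  have hm : Measurable fun p : (Fin d → ℝ) × (Fin d → ℝ) => h (p.2 + (s • p.1 + t)) :=
    hh.comp (by fun_prop)
  refine (hg'.const_mul (M * A * B)).mono
    (((hw.aestronglyMeasurable.mul hf'.1).mul hg'.1).mul hm.aestronglyMeasurable)
    (ae_of_all _ fun p => ?_)
  have e : shearProduct w f g h s t p = w p * f p.1 * h (p.2 + (s • p.1 + t)) * g p.2 := by
    simp only [shearProduct]
    ring
  rw [e, norm_mul _ (g p.2), norm_mul _ ((g ∘ Prod.snd) p)]
  refine mul_le_mul_of_nonneg_right ?_ (norm_nonneg _)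
  exact (abs_mul_le_mul (abs_mul_le_mul (hM p) (hA _)) (hB _)).trans (le_abs_self _)

theorem memLp_of_continuous {U : Set (Fin d → ℝ)} {f : (Fin d → ℝ) → ℝ} (hf : Continuous f)
    (hc : HasCompactSupport f) : MemLp f 2 (volume.restrict U) :=
  (hf.memLp_of_hasCompactSupport hc).restrict U

theorem exists_abs_le {f : (Fin d → ℝ) → ℝ} (hf : Continuous f) (hc : HasCompactSupport f) :
    ∃ A, ∀ x, |f x| ≤ A :=
  hf.bounded_above_of_compact_support hc

theorem approximable_shearProduct_of_continuous (hΩ : IsOpen Ω) (hb : Bornology.IsBounded Ω)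
    {w : (Fin d → ℝ) × (Fin d → ℝ) → ℝ} (hwc : ContinuousOn w (Ω ×ˢ unitCell d))
    {f g h : (Fin d → ℝ) → ℝ} (hf : Continuous f) (hfc : HasCompactSupport f)
    (hfΩ : tsupport f ⊆ Ω) (hg : Continuous g) (hgc : HasCompactSupport g)
    (hgY : tsupport g ⊆ unitCell d) (hh : Continuous h) (s : ℝ) (t : Fin d → ℝ) :
    Approximable Ω ε (shearProduct w f g h s t) := by
  have hsupp : tsupport (shearProduct w f g h s t) ⊆ tsupport f ×ˢ tsupport g := by
    refine closure_minimal (fun p hp => ?_) ((isClosed_tsupport f).prod (isClosed_tsupport g))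
    have hp' : w p * f p.1 * g p.2 * h (p.2 + (s • p.1 + t)) ≠ 0 := hp
    refine ⟨subset_tsupport f fun h0 => hp' ?_, subset_tsupport g fun h0 => hp' ?_⟩ <;> simp [h0]
  have hcont : ContinuousOn (shearProduct w f g h s t) (Ω ×ˢ unitCell d) :=
    ((hwc.mul (hf.comp continuous_fst).continuousOn).mul
      (hg.comp continuous_snd).continuousOn).mul
      (hh.comp (g := h) (f := fun p : (Fin d → ℝ) × (Fin d → ℝ) => p.2 + (s • p.1 + t))
        (by fun_prop)).continuousOn
  have hsub := hsupp.trans (Set.prod_mono hfΩ hgY)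
  exact .of_continuous hb.measure_lt_top.ne
    (hcont.continuous_of_tsupport_subset (hΩ.prod (isOpen_unitCell d)) hsub)
    ((hfc.isCompact.prod hgc.isCompact).of_isClosed_subset (isClosed_tsupport _) hsupp) hsub

theorem abs_indicator_one_le (U : Set (Fin d → ℝ)) (x : Fin d → ℝ) :
    |U.indicator (fun _ => (1 : ℝ)) x| ≤ 1 := by
  by_cases hx : x ∈ U <;> simp [hx]

/-- The rough factors are replaced one at a time, the other factors staying bounded. The unbounded
`g` has to go first: its continuous substitute is bounded, which the other two replacements require.
-/
theorem approximable_shearProduct_indicator (hΩ : IsOpen Ω) (hb : Bornology.IsBounded Ω)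
    (hεpos : ∀ n, 0 < ε n) (hε : Tendsto ε atTop (𝓝 0))
    {w : (Fin d → ℝ) × (Fin d → ℝ) → ℝ} (hw : Measurable w)
    (hwc : ContinuousOn w (Ω ×ˢ unitCell d)) {M : ℝ} (hM : ∀ p, |w p| ≤ M)
    {P : Set (Fin d → ℝ)} (hP : NullMeasurableSet P volume) {g : (Fin d → ℝ) → ℝ}
    (hg : MemLp g 2 (volume.restrict (unitCell d))) (s : ℝ) (t : Fin d → ℝ) :
    Approximable Ω ε (shearProduct w (P.indicator fun _ => 1) g
      ((unitCell d).indicator fun _ => 1) s t) := by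
  have hΩfin : volume Ω ≠ ⊤ := hb.measure_lt_top.ne
  have hYm := (isOpen_unitCell d).measurableSet
  have hYfin : volume (unitCell d) ≠ ⊤ := by simp [volume_unitCell]
  have hPL : MemLp (P.indicator fun _ => (1 : ℝ)) 2 (volume.restrict Ω) := by
    have : IsFiniteMeasure (volume.restrict Ω) := ⟨by simpa using hb.measure_lt_top⟩
    exact .of_bound (aestronglyMeasurable_const.indicator₀
      (hP.mono_ac Measure.restrict_le_self.absolutelyContinuous)) 1
      (ae_of_all _ (abs_indicator_one_le P))
  have hYL : MemLp ((unitCell d).indicator fun _ => (1 : ℝ)) 2 (volume.restrict (unitCell d)) :=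
    memLp_indicator_const 2 hYm 1 (Or.inr (by simpa using hYfin))
  have hYmeas : Measurable ((unitCell d).indicator fun _ => (1 : ℝ)) :=
    measurable_const.indicator hYm
  have hP1 := abs_indicator_one_le P
  have hY1 := abs_indicator_one_le (unitCell d)
  refine .of_dense hΩ hb hεpos (memLp_shearProduct hΩ hb hεpos hw hM hPL hP1 hg hYmeas hY1 s t)
    (isOpen_unitCell d) hYfin hg measurable_snd (eventually_map_snd_le hΩ hb hεpos hε)
    (M * 1 * 1) fun g' hg'c hg's hg'Y => ?_
  refine ⟨shearProduct w (P.indicator fun _ => 1) g' ((unitCell d).indicator fun _ => 1) s t,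
    ?_, fun p _ => ?_⟩
  swap
  · have e : ∀ a b c x y : ℝ, a * b * x * c - a * b * y * c = a * b * c * (x - y) := by
      intros; ring
    rw [shearProduct, shearProduct, e, abs_mul]
    exact mul_le_mul_of_nonneg_right (abs_mul_le_mul (abs_mul_le_mul (hM p) (hP1 _)) (hY1 _))
      (abs_nonneg _)
  obtain ⟨A, hA⟩ := exists_abs_le hg'c hg's
  have hg'L := memLp_of_continuous (U := unitCell d) hg'c hg's
  refine .of_dense hΩ hb hεpos (memLp_shearProduct hΩ hb hεpos hw hM hPL hP1 hg'L hYmeas hY1 s t)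
    (isOpen_unitCell d) hYfin hYL (measurable_shear s t) (eventually_map_shear_le hb hεpos hε s t)
    (M * 1 * A) fun h hhc hhs hhY => ?_
  refine ⟨shearProduct w (P.indicator fun _ => 1) g' h s t, ?_, fun p _ => ?_⟩
  swap
  · rw [shearProduct, shearProduct, ← mul_sub, abs_mul]
    refine mul_le_mul (abs_mul_le_mul (abs_mul_le_mul (hM p) (hP1 _)) (hA _)) ?_
      (abs_nonneg _) ((abs_nonneg _).trans (abs_mul_le_mul (abs_mul_le_mul (hM p) (hP1 p.1))
        (hA p.2)))
    -- The factor is not periodic, whereas `shear` reduces modulo `ℤ^d`. Inside the cell the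
    -- reduction does nothing; outside, both the indicator and `h` vanish.
    by_cases hv : p.2 + (s • p.1 + t) ∈ unitCell d
    · have : shear s t p = p.2 + (s • p.1 + t) :=
        funext fun j => Int.fract_eq_self.2 ⟨(hv j).1.le, (hv j).2⟩
      rw [this]
    · have h0 : h (p.2 + (s • p.1 + t)) = 0 :=
        image_eq_zero_of_notMem_tsupport fun hm => hv (hhY hm)
      rw [Set.indicator_of_notMem hv, h0, sub_zero, abs_zero]
      exact abs_nonneg _
  obtain ⟨B, hB⟩ := exists_abs_le hhc hhs
  refine .of_dense hΩ hb hεpos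
    (memLp_shearProduct hΩ hb hεpos hw hM hPL hP1 hg'L hhc.measurable hB s t)
    hΩ hΩfin hPL measurable_fst ⟨1, ENNReal.one_ne_top, Eventually.of_forall fun i =>
      (map_fst_scaleMeasure_le i).trans_eq (one_smul _ _).symm⟩
    (M * A * B) fun f hfc hfs hfΩ => ?_
  refine ⟨shearProduct w f g' h s t, approximable_shearProduct_of_continuous hΩ hb hwc hfc hfs hfΩ
    hg'c hg's hg'Y hhc s t, fun p _ => ?_⟩
  have e : ∀ a b c x y : ℝ, a * x * b * c - a * y * b * c = a * b * c * (x - y) := by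
    intros; ring
  rw [shearProduct, shearProduct, e, abs_mul]
  exact mul_le_mul_of_nonneg_right (abs_mul_le_mul (abs_mul_le_mul (hM p) (hA _)) (hB _))
    (abs_nonneg _)

/-! ### Decomposition of the extensions -/

theorem memLp_comp_dilation {f : (Fin d → ℝ) → ℝ} (hf : MemLp f 2 volume) {r : ℝ} (hr : 0 < r)
    (k : Fin d → ℝ) : MemLp (fun y => f (r • (y + k))) 2 volume := by
  have h : Measure.map (fun y : Fin d → ℝ => r • (y + k)) volume =
      ENNReal.ofReal |(r ^ Module.finrank ℝ (Fin d → ℝ))⁻¹| • volume := by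
    rw [← Measure.map_addHaar_smul volume hr.ne', ← map_add_right_eq_self volume k,
      Measure.map_map (measurable_const_smul r) (measurable_add_const k),
      map_add_right_eq_self volume k]
    rfl
  exact (eLpNorm_comp_le_of_map_le (by fun_prop) ENNReal.ofReal_ne_top h.le hf).1

theorem ae_shear_mem_none (s : ℝ) (t : Fin d → ℝ) :
    ∀ᵐ p ∂scaleMeasure Ω ε none, shear s t p ∈ unitCell d :=
  ae_of_ae_map (measurable_shear s t).aemeasurable
    ((Measure.absolutelyContinuous_of_le_smul (map_shear_none_le s t)).ae_le
      (ae_restrict_mem (isOpen_unitCell d).measurableSet))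

theorem ae_shear_mem_some (hb : Bornology.IsBounded Ω) {s : ℝ} {n : ℕ} (hs : (ε n)⁻¹ + s ≠ 0)
    (t : Fin d → ℝ) : ∀ᵐ p ∂scaleMeasure Ω ε (some n), shear s t p ∈ unitCell d := by
  obtain ⟨R, hR, hΩR⟩ := exists_forall_subset_Icc hb
  exact ae_of_ae_map (measurable_shear s t).aemeasurable
    ((Measure.absolutelyContinuous_of_le_smul (map_shear_some_le hR hΩR hs t)).ae_le
      (ae_restrict_mem (isOpen_unitCell d).measurableSet))

/-- The integer translates of the unit cell that meet a bounded set after a dilation. -/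
theorem exists_finset_of_dilation_mem {Ω' : Set (Fin d → ℝ)} (hb : Bornology.IsBounded Ω')
    {r : ℝ} (hr : 0 < r) : ∃ K : Finset (Fin d → ℤ), ∀ y ∈ unitCell d, ∀ k : Fin d → ℤ,
      r • (y + fun i => (k i : ℝ)) ∈ Ω' → k ∈ K := by
  obtain ⟨R, hR, hΩR⟩ := exists_forall_subset_Icc hb
  -- The extra `-1` at the lower end is due to `y` ranging over `(0,1)`.
  refine ⟨Finset.Icc (fun _ => -⌈R / r⌉ - 1) (fun _ => ⌈R / r⌉), fun y hy k hk => ?_⟩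
  have h1 := fun i => (hΩR hk).1 i
  have h2 := fun i => (hΩR hk).2 i
  simp only [Pi.smul_apply, Pi.add_apply, smul_eq_mul] at h1 h2
  have hc := Int.le_ceil (R / r)
  refine Finset.mem_Icc.2 ⟨fun i => ?_, fun i => ?_⟩
  · have : -(R / r) ≤ y i + k i := by
      rw [← neg_div, div_le_iff₀ hr, mul_comm]
      exact h1 i
    have h3 : (-⌈R / r⌉ - 1 : ℝ) ≤ k i := by linarith [(hy i).2]
    exact_mod_cast h3
  · have : y i + k i ≤ R / r := by
      rw [le_div_iff₀ hr, mul_comm]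
      exact h2 i
    have h3 : (k i : ℝ) ≤ ⌈R / r⌉ := by linarith [(hy i).1]
    exact_mod_cast h3

/-- The coordinate `v` is chosen so that the cube becomes the unit cell. Subtracting `⌊v⌋` from `y`
moves `r y` into the cube, provided that it is not congruent to a point of a face. -/
theorem IsPeriodicCellExtension.eq_of_shear_mem {r : ℝ} (hr : 0 < r) {aM : (Fin d → ℝ) → ℝ}
    {c v y : Fin d → ℝ} {b : (Fin d → ℝ) → ℝ} (hb : IsPeriodicCellExtension r aM c b)
    (hv : ∀ i, r * v i = r * y i - c i + r / 2) (hmem : cellFract v ∈ unitCell d) :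
    r • (y + fun i => ((-⌊v i⌋ : ℤ) : ℝ)) ∈ cube r c ∧
      b y = aM (r • (y + fun i => ((-⌊v i⌋ : ℤ) : ℝ))) := by
  have hz : r • (y + fun i => ((-⌊v i⌋ : ℤ) : ℝ)) ∈ cube r c := fun i => by
    have h := hmem i
    have e : (r • (y + fun i => ((-⌊v i⌋ : ℤ) : ℝ))) i - c i = r * (cellFract v i - 1 / 2) := by
      simp only [Pi.smul_apply, Pi.add_apply, smul_eq_mul, cellFract, Int.fract]
      push_cast
      linarith [hv i]
    rw [e, abs_mul, abs_of_pos hr, div_eq_mul_one_div r 2]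
    exact mul_lt_mul_of_pos_left (abs_lt.2 ⟨by linarith [h.1], by linarith [h.2]⟩) hr
  refine ⟨hz, ?_⟩
  rw [← hb.2 _ hz, inv_smul_smul₀ hr.ne']
  exact (hb.1 y fun i => -⌊v i⌋).symm

/-- Functions built from the values of `aM` in cubes whose centers depend on `x` in a piecewise
affine way are approximable, also after multiplication by a continuous function. -/
theorem approximable_extension_mul {Ω' : Set (Fin d → ℝ)} (hΩ : IsOpen Ω)
    (hb : Bornology.IsBounded Ω) (hΩ' : IsOpen Ω') (hb' : Bornology.IsBounded Ω') {r : ℝ}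
    (hr : 0 < r) {aM : (Fin d → ℝ) → ℝ} (haM : MemLp aM 2 (volume.restrict Ω'))
    {ψ : (Fin d → ℝ) × (Fin d → ℝ) → ℝ}
    (hψ : ContinuousOn ψ (closure Ω ×ˢ closure (unitCell d)))
    (hεpos : ∀ n, 0 < ε n) (hε : Tendsto ε atTop (𝓝 0)) {N : ℕ} {P : Fin N → Set (Fin d → ℝ)}
    (hPd : ∀ i j, i ≠ j → Disjoint (P i) (P j)) (hPm : ∀ j, NullMeasurableSet (P j) volume)
    (hPc : volume (Ω \ ⋃ j, P j) = 0) (θ : ℝ) (c : Fin N → Fin d → ℝ)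
    (hcube : ∀ j, ∀ x ∈ Ω ∩ P j, cube r (θ • x + c j) ⊆ Ω')
    {a : (Fin d → ℝ) × (Fin d → ℝ) → ℝ}
    (ha : ∀ j, ∀ x ∈ Ω ∩ P j, IsPeriodicCellExtension r aM (θ • x + c j) fun y => a (x, y))
    (hface : ∀ i j, ∀ᵐ p ∂scaleMeasure Ω ε i,
      shear (-θ / r) (fun l => 1 / 2 - c j l / r) p ∈ unitCell d) :
    Approximable Ω ε fun p => a p * ψ p := by
  have hcl : IsClosed (closure Ω ×ˢ closure (unitCell d)) := isClosed_closure.prod isClosed_closure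
  have hcomp : IsCompact (closure Ω ×ˢ closure (unitCell d)) :=
    hb.isCompact_closure.prod (isCompact_closure_unitCell d)
  have hsub : Ω ×ˢ unitCell d ⊆ closure Ω ×ˢ closure (unitCell d) :=
    Set.prod_mono subset_closure subset_closure
  -- Extension by zero from a compact set gives a weight that is measurable and bounded everywhere,
  -- and nothing changes on `Ω × Y`.
  set w := (closure Ω ×ˢ closure (unitCell d)).indicator ψ with hwdef
  have hw : Measurable w := by
    classical
    have := hψ.measurable_piecewise (g := 0) continuousOn_const hcl.measurableSet
    rwa [Set.piecewise_eq_indicator] at this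
  have hwψ : ∀ p ∈ Ω ×ˢ unitCell d, w p = ψ p := fun p hp => Set.indicator_of_mem (hsub hp) ψ
  have hwc : ContinuousOn w (Ω ×ˢ unitCell d) := (hψ.mono hsub).congr hwψ
  obtain ⟨M, hM⟩ : ∃ M, ∀ p, |w p| ≤ M := by
    obtain ⟨M, hM⟩ := hcomp.exists_bound_of_continuousOn hψ
    refine ⟨max M 0, fun p => ?_⟩
    by_cases hp : p ∈ closure Ω ×ˢ closure (unitCell d)
    · rw [hwdef, Set.indicator_of_mem hp]
      exact (hM p hp).trans (le_max_left _ _)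
    · rw [hwdef, Set.indicator_of_notMem hp, abs_zero]
      exact le_max_right _ _
  obtain ⟨K, hK⟩ := exists_finset_of_dilation_mem hb' hr
  set g : (Fin d → ℤ) → (Fin d → ℝ) → ℝ := fun k y =>
    Ω'.indicator aM (r • (y + fun i => (k i : ℝ))) with hgdef
  have hg : ∀ k, MemLp (g k) 2 (volume.restrict (unitCell d)) := fun k =>
    (memLp_comp_dilation ((memLp_indicator_iff_restrict hΩ'.measurableSet).2 haM) hr _).restrict _
  -- With `v = y + (-θ/r) x + 1/2 - c j/r`, the last factor selects the points with `v + k` in the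
  -- cell, that is, those where `r (y + k)` lies in the cube centered at `θ x + c j`.
  set φ : Fin N → (Fin d → ℤ) → (Fin d → ℝ) × (Fin d → ℝ) → ℝ := fun j k =>
    shearProduct w ((P j).indicator fun _ => 1) (g k) ((unitCell d).indicator fun _ => 1) (-θ / r)
      ((fun l => 1 / 2 - c j l / r) + fun i => (k i : ℝ)) with hφdef
  have hφ : Approximable Ω ε (∑ j, ∑ k ∈ K, φ j k) :=
    .sum _ fun j _ => .sum _ fun k _ =>
      approximable_shearProduct_indicator hΩ hb hεpos hε hw hwc hM (hPm j) (hg k) _ _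
  refine hφ.congr_ae fun i => ?_
  have hcover : ∀ᵐ p ∂scaleMeasure Ω ε i, p.1 ∈ ⋃ j, P j := by
    have h0 : ∀ᵐ x ∂volume.restrict Ω, x ∈ ⋃ j, P j := by
      rw [ae_restrict_iff' hΩ.measurableSet]
      refine measure_mono_null (fun x hx => ?_) hPc
      exact Classical.not_imp.1 hx
    exact ae_of_ae_map measurable_fst.aemeasurable
      ((Measure.absolutelyContinuous_of_le (map_fst_scaleMeasure_le i)).ae_le h0)
  filter_upwards [ae_mem_scaleMeasure hΩ hb hεpos i, hcover, ae_all_iff.2 (hface i)]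
    with p hp hpc hpf
  obtain ⟨j, hj⟩ := Set.mem_iUnion.1 hpc
  have hx : p.1 ∈ Ω ∩ P j := ⟨hp.1, hj⟩
  set v : Fin d → ℝ := p.2 + ((-θ / r) • p.1 + fun l => 1 / 2 - c j l / r) with hvdef
  obtain ⟨hz, hav⟩ := (ha j p.1 hx).eq_of_shear_mem hr (v := v) (y := p.2) (fun l => by
    simp only [hvdef, Pi.add_apply, Pi.smul_apply, smul_eq_mul]
    field_simp
    ring) (hpf j)
  have hz' := hcube j p.1 hx hz
  have hvk : ∀ k : Fin d → ℤ, p.2 + ((-θ / r) • p.1 +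
      ((fun l => 1 / 2 - c j l / r) + fun i => (k i : ℝ))) = v + fun i => (k i : ℝ) := fun k => by
    rw [hvdef, add_assoc, add_assoc]
  -- Only one term survives: `j` is the piece containing `x`, and `k = -⌊v⌋` is the only shift
  -- bringing `v` into the cell.
  rw [Finset.sum_apply, Finset.sum_eq_single j, Finset.sum_apply,
    Finset.sum_eq_single fun i => -⌊v i⌋]
  · have hY : (v + fun i => ((-⌊v i⌋ : ℤ) : ℝ)) ∈ unitCell d := by
      have e : (v + fun i => ((-⌊v i⌋ : ℤ) : ℝ)) = cellFract v := funext fun l => by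
        simp only [Pi.add_apply, cellFract, Int.fract]
        push_cast
        ring
      rw [e]
      exact hpf j
    simp only [hφdef, shearProduct]
    rw [hvk, Set.indicator_of_mem hj, Set.indicator_of_mem hY, hwψ p hp, hgdef]
    simp only
    rw [Set.indicator_of_mem hz', ← hav]
    ring
  · intro k _ hk
    have hY : (v + fun i => (k i : ℝ)) ∉ unitCell d := fun hmem => hk (funext fun l => by
      have h := hmem l
      simp only [Pi.add_apply] at h
      have : ⌊v l⌋ = -k l := Int.floor_eq_iff.2 ⟨by push_cast; linarith [h.1],
        by push_cast; linarith [h.2]⟩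
      omega)
    simp only [hφdef, shearProduct]
    rw [hvk, Set.indicator_of_notMem hY, mul_zero]
  · exact fun h => absurd (hK p.2 hp.2 _ hz') h
  · intro j' _ hj'
    have hnot : p.1 ∉ P j' := fun h => Set.disjoint_left.1 (hPd j' j hj') h hj
    rw [Finset.sum_apply]
    refine Finset.sum_eq_zero fun k _ => ?_
    simp only [hφdef, shearProduct]
    rw [Set.indicator_of_notMem hnot, mul_zero, zero_mul, zero_mul]
  · exact fun h => absurd (Finset.mem_univ j) h

theorem CellPeriodic.mul {b b' : (Fin d → ℝ) → ℝ} (h : CellPeriodic b) (h' : CellPeriodic b') :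
    CellPeriodic fun y => b y * b' y := fun y k => by
  simp only [h y k, h' y k]

end TwoScale

theorem mainTheorem1 {d : ℕ} (Ω Ω' : Set (Fin d → ℝ))
    (hΩ : IsOpen Ω) (hΩb : Bornology.IsBounded Ω)
    (hΩ' : IsOpen Ω') (hΩ'b : Bornology.IsBounded Ω') (hsub : Ω ⊆ Ω')
    (εbar : ℝ) (hεbar : 0 < εbar)
    (aM : (Fin d → ℝ) → ℝ) (haM : MemLp aM 2 (volume.restrict Ω'))
    (ψ : (Fin d → ℝ) × (Fin d → ℝ) → ℝ)
    (hψ : ContinuousOn ψ (closure Ω ×ˢ closure (TwoScale.unitCell d)))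
    (hψper : ∀ x ∈ closure Ω, TwoScale.CellPeriodic (fun y => ψ (x, y)))
    (ε : ℕ → ℝ) (hεpos : ∀ n, 0 < ε n) (hε : Tendsto ε atTop (𝓝 0)) :
    ((∀ x ∈ Ω, TwoScale.cube εbar x ⊆ Ω') →
      ∀ a, TwoScale.IsContinuousExtension Ω εbar aM a →
        TwoScale.IsAdmissible Ω ε (fun p => a p * ψ p)) ∧
    (∀ (N : ℕ) (P : Fin N → Set (Fin d → ℝ)) (c : Fin N → Fin d → ℝ),
      TwoScale.IsFinitePartition Ω P →
      (∀ j, TwoScale.cube εbar (c j) ⊆ Ω') →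
      (∀ j, P j ⊆ closure (TwoScale.cube εbar (c j))) →
      ∀ a, TwoScale.IsDiscreteExtension Ω P c εbar aM a →
        TwoScale.IsAdmissible Ω ε (fun p => a p * ψ p)) := by
  refine ⟨fun hcube a ha => ?_, fun N P c hP hcube _ a ha => ?_⟩
  -- The Continuous extension is the case of the single piece `Ω` and the center `θ x + c` with `θ =
  -- 1`, `c = 0`.
  · refine (TwoScale.approximable_extension_mul hΩ hΩb hΩ' hΩ'b hεbar haM hψ hεpos hε
      (P := fun _ : Fin 1 => Ω) (fun i j hij => absurd (Subsingleton.elim i j) hij)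
      (fun _ => hΩ.measurableSet.nullMeasurableSet)
      (measure_mono_null (fun x hx => absurd (Set.mem_iUnion.2 ⟨0, hx.1⟩) hx.2) measure_empty)
      1 (fun _ => 0)
      (fun _ x hx => by simpa using hcube x hx.1) (fun _ x hx => by simpa using ha x hx.1)
      fun i _ => ?_).isAdmissible hΩ fun x hx => (ha x hx).1.mul (hψper x (subset_closure hx))
    cases i with
    | none => exact TwoScale.ae_shear_mem_none _ _
    | some n =>
      -- If `ε n = εbar`, the sheared variable is constant along the samples and its law is not
      -- dominated by Lebesgue measure. It then sits at the center `(1/2, …, 1/2)` of the cell, away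
      -- from the faces.
      by_cases hs : (ε n)⁻¹ + -1 / εbar = 0
      · refine (ae_map_iff (TwoScale.measurable_scaleMap _).aemeasurable
          (TwoScale.measurable_shear _ _ (TwoScale.isOpen_unitCell d).measurableSet)).2
          (ae_of_all _ fun x => ?_)
        rw [TwoScale.shear_scaleMap, hs]
        intro l
        have : Int.fract (1 / 2 : ℝ) = 1 / 2 := Int.fract_eq_self.2 ⟨by norm_num, by norm_num⟩
        simp only [TwoScale.cellFract, zero_smul, Pi.add_apply, Pi.zero_apply, zero_add, zero_div,
          sub_zero, this]
        norm_num
      · exact TwoScale.ae_shear_mem_some hΩb hs _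
  -- The Discrete extension has centers independent of `x` on each piece, hence `θ = 0`, and `1/ε n
  -- + s` never vanishes.
  · refine (TwoScale.approximable_extension_mul hΩ hΩb hΩ' hΩ'b hεbar haM hψ hεpos hε
      hP.pairwise_disjoint hP.nullMeasurable hP.ae_cover 0 c
      (fun j x _ => by simpa using hcube j) (fun j x hx => by simpa using ha.2 j x hx)
      fun i j => ?_).isAdmissible hΩ fun x hx => (ha.1 x hx).mul (hψper x (subset_closure hx))
    cases i with
    | none => exact TwoScale.ae_shear_mem_none _ _
    | some n => exact TwoScale.ae_shear_mem_some hΩb (by simpa using (hεpos n).ne') _
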